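/- For an ideal $I$ of a commutative ring $A$ let $\alpha:\mathbf S(I)\to\mathcal R(I)=\bigoplus_{n\ge 0}I^nt^n$ be the canonical graded surjection from the symmetric algebra of the $A$-module $I$ onto the Rees algebra of $I$, and let $E(I)_n=\ker\alpha_n/\mathbf S_1(I)\cdot\ker\alpha_{n-1}$ for $n\ge 2$ and $E(I)_0=E(I)_1=0$. The relation type $\mathrm{rt}(I)\in\mathbb N\cup\{\infty\}$ is the least integer $r\ge 1$ with $E(I)_n=0$ for all $n\ge r+1$ (and $\infty$ if there is none), and $\mathrm{grt}(A)=\sup\{\mathrm{rt}(I)\mid I\text{ an ideal of }A\}$ is the global relation type of $A$. For a Noetherian local ring $(A,\mathfrak m)$ of dimension $d$, $e(A)$ denotes its multiplicity: $e(A)/d!$ is the coefficient of $n^d$ in the polynomial that agrees with $\mathrm{length}(A/\mathfrak m^n)$ for all large $n$. Let $k$ be a field and $g\ge 1$ an integer. Set $R=k[t^{g+1},t^{g+2},\ldots,t^{2g+1}]\subset k[t]$ ($t$ a variable over $k$), $\mathfrak n=(t^{g+1},t^{g+2},\ldots,t^{2g+1})\subset R$, $A=R_{\mathfrak n}$ and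 $\mathfrak m=\mathfrak nR_{\mathfrak n}$. Then $(A,\mathfrak m)$ is a one-dimensional Noetherian local domain with residue field $k$ (that is, $k\to A/\mathfrak m$ is an isomorphism), and $\mathrm{grt}(A)=e(A)=g+1$. Moreover $\mathrm{rt}(\mathfrak m)=2$. -/

import Mathlib

open Polynomial

noncomputable section

namespace GlobalRelationType

section RelationType

universe u

/-- The degree one inclusion of an ideal `I` into its Rees algebra `⨁ Iⁿ tⁿ ⊆ A[t]`,
sending `x` to `x t`. -/
def reesDegreeOne {A : Type u} [CommRing A] (I : Ideal A) : I →ₗ[A] reesAlgebra I where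
  toFun x := ⟨monomial 1 (x : A), reesAlgebra.monomial_mem.2 (by simp)⟩
  map_add' x y := Subtype.ext (by simp)
  map_smul' a x := Subtype.ext (by simp [smul_monomial])

/-- The canonical (surjective, graded) morphism `α : Sym(I) → Rees(I)` induced by the identity
in degree one. -/
def symToRees {A : Type u} [CommRing A] (I : Ideal A) :
    SymmetricAlgebra A I →ₐ[A] reesAlgebra I :=
  SymmetricAlgebra.lift (reesDegreeOne I)

/-- The homogeneous component of degree `n` of the symmetric algebra of `I`: the `A`-submodule
spanned by the products of `n` elements of `I`. -/
def symPiece {A : Type u} [CommRing A] (I : Ideal A) (n : ℕ) :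
    Submodule A (SymmetricAlgebra A I) :=
  LinearMap.range (SymmetricAlgebra.ι A I) ^ n

/-- The degree `n` component of the kernel of `α : Sym(I) → Rees(I)`. -/
def relations {A : Type u} [CommRing A] (I : Ideal A) (n : ℕ) :
    Submodule A (SymmetricAlgebra A I) :=
  LinearMap.ker (symToRees I).toLinearMap ⊓ symPiece I n

/-- The module of effective `n`-relations `E(I)ₙ = ker αₙ / Sym₁(I) · ker αₙ₋₁`.
(For `n = 0` and `n = 1` the numerator is already zero.) -/
abbrev EffectiveRelations {A : Type u} [CommRing A] (I : Ideal A) (n : ℕ) : Type u :=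
  relations I n ⧸ (symPiece I 1 * relations I (n - 1)).submoduleOf (relations I n)

/-- The relation type of an ideal: the least `r ≥ 1` such that `E(I)ₙ = 0` for all `n ≥ r + 1`,
and `⊤` if there is no such integer. -/
def relationType {A : Type u} [CommRing A] (I : Ideal A) : ℕ∞ :=
  sInf {r : ℕ∞ | 1 ≤ r ∧ ∀ n : ℕ, r < (n : ℕ∞) → Subsingleton (EffectiveRelations I n)}

/-- The global relation type of a ring: the supremum of the relation types of all its ideals. -/
def globalRelationType (A : Type u) [CommRing A] : ℕ∞ :=
  ⨆ I : Ideal A, relationType I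

/-- The (Hilbert–Samuel) multiplicity of the local ring `A` is `e`: if `d = dim A`, then
`n ↦ length (A / 𝔪ⁿ)` agrees for large `n` with a polynomial of degree `d` and leading
coefficient `e / d!`. -/
def HasMultiplicity (A : Type u) [CommRing A] [IsLocalRing A] (e : ℕ) : Prop :=
  ∃ (d : ℕ) (p : ℚ[X]), ringKrullDim A = d ∧ p.natDegree = d ∧
    p.leadingCoeff * (d.factorial : ℚ) = e ∧
    ∃ N : ℕ, ∀ n ≥ N, ∃ l : ℕ,
      Module.length A (A ⧸ IsLocalRing.maximalIdeal A ^ n) = (l : ℕ∞) ∧ p.eval (n : ℚ) = l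

end RelationType

section Example

universe u

/-- The subalgebra `R = k[t^(g+1), …, t^(2g+1)]` of the polynomial ring `k[t]`. -/
def monomialRing (k : Type u) [Field k] (g : ℕ) : Subalgebra k k[X] :=
  Algebra.adjoin k {p | ∃ i ∈ Finset.Icc (g + 1) (2 * g + 1), p = X ^ i}

/-- The ideal `𝔫 = (t^(g+1), …, t^(2g+1))` of `R`. -/
def monomialIdeal (k : Type u) [Field k] (g : ℕ) : Ideal (monomialRing k g) :=
  Ideal.span {r | ∃ i ∈ Finset.Icc (g + 1) (2 * g + 1), (r : k[X]) = X ^ i}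

/-- The constant coefficient, as a `k`-algebra morphism `R → k`. -/
def constantTerm (k : Type u) [Field k] (g : ℕ) : monomialRing k g →ₐ[k] k :=
  (aeval (0 : k)).comp (monomialRing k g).val

theorem sub_constantTerm_mem (k : Type u) [Field k] (g : ℕ) (r : monomialRing k g) :
    r - algebraMap k (monomialRing k g) (constantTerm k g r) ∈ monomialIdeal k g := by
  obtain ⟨p, hp⟩ := r
  change p ∈ Algebra.adjoin k _ at hp
  induction hp using Algebra.adjoin_induction with
  | mem x hx =>
    obtain ⟨i, hi, rfl⟩ := hx
    have hi0 : i ≠ 0 := by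
      have := (Finset.mem_Icc.1 hi).1
      omega
    have h0 : constantTerm k g ⟨X ^ i, Algebra.subset_adjoin ⟨i, hi, rfl⟩⟩ = 0 := by
      simp [constantTerm, hi0]
    rw [h0, map_zero, sub_zero]
    exact Ideal.subset_span ⟨i, hi, rfl⟩
  | algebraMap c =>
    have h0 : (⟨algebraMap k k[X] c, (monomialRing k g).algebraMap_mem c⟩ : monomialRing k g) =
        algebraMap k (monomialRing k g) c := rfl
    rw [h0, AlgHom.commutes, Algebra.algebraMap_self_apply, sub_self]
    exact Ideal.zero_mem _
  | add x y hx hy ihx ihy =>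
    have := Ideal.add_mem _ ihx ihy
    have h0 : (⟨x + y, add_mem hx hy⟩ : monomialRing k g) = ⟨x, hx⟩ + ⟨y, hy⟩ := rfl
    rw [h0, map_add, map_add]
    convert this using 1
    ring
  | mul x y hx hy ihx ihy =>
    have := Ideal.add_mem _ (Ideal.mul_mem_left _ ⟨x, hx⟩ ihy)
      (Ideal.mul_mem_left _ (algebraMap k (monomialRing k g) (constantTerm k g ⟨y, hy⟩)) ihx)
    have h0 : (⟨x * y, mul_mem hx hy⟩ : monomialRing k g) = ⟨x, hx⟩ * ⟨y, hy⟩ := rfl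
    rw [h0, map_mul, map_mul]
    convert this using 1
    ring

theorem monomialIdeal_eq_ker (k : Type u) [Field k] (g : ℕ) :
    monomialIdeal k g = RingHom.ker (constantTerm k g) := by
  apply le_antisymm
  · refine Ideal.span_le.2 ?_
    rintro r ⟨i, hi, hr⟩
    have hi0 : i ≠ 0 := by
      have := (Finset.mem_Icc.1 hi).1
      omega
    change constantTerm k g r = 0
    simp [constantTerm, hr, hi0]
  · intro r hr
    have h := sub_constantTerm_mem k g r
    rwa [(RingHom.mem_ker).1 hr, map_zero, sub_zero] at h

instance monomialIdeal_isMaximal (k : Type u) [Field k] (g : ℕ) :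
    (monomialIdeal k g).IsMaximal := by
  rw [monomialIdeal_eq_ker]
  refine RingHom.ker_isMaximal_of_surjective _ fun c => ⟨algebraMap k _ c, ?_⟩
  simp

/-- The localization `A = R_𝔫`. -/
abbrev LocalMonomialRing (k : Type u) [Field k] (g : ℕ) : Type u :=
  Localization.AtPrime (monomialIdeal k g)

end Example

end GlobalRelationType

end

/-! Taylor expansion at `t = 0` embeds `A` in `k⟦t⟧`. An element of `A` has no terms in `t, …, t^g`,
every `t^j` with `j ≥ g + 1` lies in `A`, and `x` divides `f` in `A` once the order of `f` exceeds
that of `x` by at least `g + 1`. `IsTruncatedEmbedding` records these facts, and everything else is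
deduced from them.

Upper bound: let `x` have minimal order in a nonzero ideal `I`. The first `g + 1` coefficients of `f
/ xⁿ`, for `f ∈ Iⁿ`, form an increasing chain of nonzero subspaces of `k^(g+1)`. Two consecutive
ones agree for some `n ≤ g`, and divisibility in `A` turns this into `Iⁿ⁺¹ = x Iⁿ`
(`exists_reduction`). A regular principal reduction with reduction number `n` forces relation type
at most `n + 1` (`relationType_le_of_reduction`).

Lower bound: for `I = (t^(g+1), t^(g+2))`, reading off the two lowest coefficients gives an algebra
map from `Sym(I)` to `k[X]`. In degree `n` its values have degree at most `n` and agree modulo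
`t^(g+1)` with the Rees image divided by `t^((g+1)n)`. Relations of degree `g` therefore go to `0`,
while a relation of degree `g + 1` goes to `X^(g+1)`. The same map on `𝔪` gives `E(𝔪)₂ ≠ 0`, and `𝔪²
= t^(g+1) 𝔪` gives `rt(𝔪) ≤ 2`.

Multiplicity: `𝔪ⁿ` consists of the elements of order at least `(g+1)n`, and its colength is counted
one power of `t` at a time. -/

namespace GlobalRelationType

/-! ### Effective relations: vanishing from reductions, detection by algebra maps. -/

section Relations

universe u

variable {A : Type u} [CommRing A] (I : Ideal A)

theorem symToRees_ι (x : I) :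
    ((symToRees I (SymmetricAlgebra.ι A I x) : reesAlgebra I) : A[X]) = monomial 1 (x : A) := by
  rw [symToRees, SymmetricAlgebra.lift_ι_apply]
  rfl

theorem ι_mem_symPiece_one (x : I) : SymmetricAlgebra.ι A I x ∈ symPiece I 1 := by
  rw [symPiece, pow_one]
  exact ⟨x, rfl⟩

theorem symPiece_one_mul (n : ℕ) : symPiece I 1 * symPiece I n = symPiece I (n + 1) := by
  rw [symPiece, symPiece, symPiece, pow_one, pow_succ']

theorem ι_mul_mem_symPiece (x : I) {n : ℕ} {z : SymmetricAlgebra A I} (hz : z ∈ symPiece I n) :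
    SymmetricAlgebra.ι A I x * z ∈ symPiece I (n + 1) := by
  rw [← symPiece_one_mul]
  exact Submodule.mul_mem_mul (ι_mem_symPiece_one I x) hz

theorem mem_relations {n : ℕ} {z : SymmetricAlgebra A I} :
    z ∈ relations I n ↔ symToRees I z = 0 ∧ z ∈ symPiece I n :=
  Iff.rfl

/-- `α` maps the `n`-th piece of the symmetric algebra into `Iⁿ tⁿ`. -/
theorem exists_symToRees_eq_monomial {n : ℕ} {z : SymmetricAlgebra A I} (hz : z ∈ symPiece I n) :
    ∃ a ∈ I ^ n, ((symToRees I z : reesAlgebra I) : A[X]) = monomial n a := by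
  rw [symPiece] at hz
  induction hz using Submodule.pow_induction_on_left' with
  | algebraMap r =>
    refine ⟨r, by simp, ?_⟩
    rw [AlgHom.commutes]
    rfl
  | add x y i hx hy ihx ihy =>
    obtain ⟨a, ha, hxa⟩ := ihx
    obtain ⟨b, hb, hyb⟩ := ihy
    exact ⟨a + b, add_mem ha hb, by rw [map_add, Subalgebra.coe_add, hxa, hyb, map_add]⟩
  | mem_mul m hm i x hx ih =>
    obtain ⟨a, ha, hxa⟩ := ih
    obtain ⟨y, rfl⟩ := hm
    refine ⟨y * a, ?_, ?_⟩
    · rw [Nat.succ_eq_add_one, pow_succ']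
      exact Ideal.mul_mem_mul y.2 ha
    · rw [map_mul, Subalgebra.coe_mul, symToRees_ι, hxa, monomial_mul_monomial, add_comm 1 i]

/-- `α` maps the `n`-th piece of the symmetric algebra onto `Iⁿ tⁿ`. -/
theorem exists_mem_symPiece_symToRees_eq {n : ℕ} {a : A} (ha : a ∈ I ^ n) :
    ∃ z ∈ symPiece I n, ((symToRees I z : reesAlgebra I) : A[X]) = monomial n a := by
  induction n generalizing a with
  | zero =>
    refine ⟨algebraMap A _ a, ?_, ?_⟩
    · rw [symPiece, pow_zero]
      exact Submodule.algebraMap_mem a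
    · rw [AlgHom.commutes]
      rfl
  | succ n ih =>
    rw [pow_succ'] at ha
    refine Submodule.mul_induction_on ha ?_ ?_
    · intro m hm b hb
      obtain ⟨z, hz, hzb⟩ := ih hb
      refine ⟨SymmetricAlgebra.ι A I ⟨m, hm⟩ * z, ι_mul_mem_symPiece I _ hz, ?_⟩
      rw [map_mul, Subalgebra.coe_mul, symToRees_ι, hzb, monomial_mul_monomial, add_comm 1 n]
    · rintro b c ⟨y, hy, hyb⟩ ⟨z, hz, hzc⟩
      exact ⟨y + z, add_mem hy hz, by rw [map_add, Subalgebra.coe_add, hyb, hzc, map_add]⟩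

theorem subsingleton_effectiveRelations_iff (n : ℕ) :
    Subsingleton (EffectiveRelations I n) ↔
      relations I n ≤ symPiece I 1 * relations I (n - 1) := by
  rw [Submodule.Quotient.subsingleton_iff, Submodule.submoduleOf_eq_top]

theorem symToRees_eq_zero_of_mem_mul_relations {n m : ℕ} {z : SymmetricAlgebra A I}
    (hz : z ∈ symPiece I n * relations I m) : symToRees I z = 0 := by
  induction hz using Submodule.mul_induction_on' with
  | mem_mul_mem x _ y hy => rw [map_mul, ((mem_relations I).1 hy).1, mul_zero]
  | add x _ y _ hx hy => rw [map_add, hx, hy, add_zero]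

/-- If `Iⁿ⁺¹ = x Iⁿ` with `x ∈ I` regular, then `E(I)ₙ₊₂ = 0`. -/
theorem subsingleton_effectiveRelations_of_reduction {x : A} (hx : x ∈ I)
    (hreg : ∀ a, x * a = 0 → a = 0) {n : ℕ}
    (hred : ∀ f ∈ I ^ (n + 1), ∃ f' ∈ I ^ n, f = x * f') :
    Subsingleton (EffectiveRelations I (n + 2)) := by
  rw [subsingleton_effectiveRelations_iff]
  change relations I (n + 2) ≤ symPiece I 1 * relations I (n + 1)
  set X₁ := SymmetricAlgebra.ι A I ⟨x, hx⟩ with hX₁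
  -- Modulo `Sym₁ · ker αₙ₊₁`, every form of degree `n + 2` is a multiple of `X₁`: in a product `m *
  -- w` the factor `w` has Rees image `x c` with `c ∈ Iⁿ`, so `w` may be replaced by `X₁` times a
  -- lift of `c`.
  have key : ∀ z ∈ symPiece I (n + 2), ∃ y ∈ symPiece I (n + 1),
      z - X₁ * y ∈ symPiece I 1 * relations I (n + 1) := by
    intro z hz
    rw [← symPiece_one_mul] at hz
    refine Submodule.mul_induction_on hz ?_ ?_
    · intro m hm w hw
      obtain ⟨b, hb, hwb⟩ := exists_symToRees_eq_monomial I hw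
      obtain ⟨c, hc, rfl⟩ := hred b hb
      obtain ⟨v, hv, hvc⟩ := exists_mem_symPiece_symToRees_eq I hc
      refine ⟨m * v, symPiece_one_mul I n ▸ Submodule.mul_mem_mul hm hv, ?_⟩
      have h1 : m * w - X₁ * (m * v) = m * (w - X₁ * v) := by ring
      rw [h1]
      refine Submodule.mul_mem_mul hm ((mem_relations I).2
        ⟨Subtype.ext ?_, sub_mem hw (ι_mul_mem_symPiece I _ hv)⟩)
      rw [map_sub, map_mul, Subalgebra.coe_sub, Subalgebra.coe_mul, hwb, hvc, hX₁, symToRees_ι,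
        monomial_mul_monomial, add_comm 1 n, sub_self, Subalgebra.coe_zero]
    · rintro z z' ⟨y, hy, hzy⟩ ⟨y', hy', hzy'⟩
      refine ⟨y + y', add_mem hy hy', ?_⟩
      rw [mul_add, add_sub_add_comm]
      exact add_mem hzy hzy'
  intro z hz
  obtain ⟨hz0, hzn⟩ := (mem_relations I).1 hz
  obtain ⟨y, hy, hzy⟩ := key z hzn
  obtain ⟨c, -, hyc⟩ := exists_symToRees_eq_monomial I hy
  have h0 := symToRees_eq_zero_of_mem_mul_relations I hzy
  -- As `z` is a relation, so is `X₁ * y`; regularity of `x` then makes `y` itself a relation.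
  rw [map_sub, hz0, zero_sub, neg_eq_zero] at h0
  have h1 := congrArg (Subtype.val) h0
  rw [map_mul, Subalgebra.coe_mul, hyc, hX₁, symToRees_ι, monomial_mul_monomial,
    Subalgebra.coe_zero, monomial_eq_zero_iff] at h1
  have hyr : y ∈ relations I (n + 1) := (mem_relations I).2
    ⟨Subtype.ext (by rw [hyc, hreg c h1, map_zero, Subalgebra.coe_zero]), hy⟩
  have h2 := Submodule.mul_mem_mul (ι_mem_symPiece_one I ⟨x, hx⟩) hyr
  have h3 : z = z - X₁ * y + X₁ * y := by ring
  rw [h3]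
  exact add_mem hzy h2

theorem relationType_le {r : ℕ} (hr : 1 ≤ r)
    (h : ∀ n : ℕ, r < n → Subsingleton (EffectiveRelations I n)) : relationType I ≤ r :=
  sInf_le ⟨by exact_mod_cast hr, fun n hn => h n (by exact_mod_cast hn)⟩

theorem le_relationType {n : ℕ} (h : ¬ Subsingleton (EffectiveRelations I n)) :
    (n : ℕ∞) ≤ relationType I :=
  le_sInf fun _ hr => not_lt.1 fun hlt => h (hr.2 n hlt)

/-- If `Iʳ⁺¹ = x Iʳ` with `x ∈ I` regular, then the relation type of `I` is at most `r + 1`. -/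
theorem relationType_le_of_reduction {x : A} (hx : x ∈ I) (hreg : ∀ a, x * a = 0 → a = 0) {r : ℕ}
    (hred : ∀ f ∈ I ^ (r + 1), ∃ f' ∈ I ^ r, f = x * f') : relationType I ≤ (r + 1 : ℕ) := by
  have hred' : ∀ s, r ≤ s → ∀ f ∈ I ^ (s + 1), ∃ f' ∈ I ^ s, f = x * f' := by
    intro s hs
    induction s, hs using Nat.le_induction with
    | base => exact hred
    | succ s _ ih =>
      intro f hf
      rw [pow_succ] at hf
      refine Submodule.mul_induction_on hf ?_ ?_
      · intro a ha b hb
        obtain ⟨a', ha', rfl⟩ := ih a ha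
        exact ⟨a' * b, by rw [pow_succ]; exact Ideal.mul_mem_mul ha' hb, by ring⟩
      · rintro _ _ ⟨a, ha, rfl⟩ ⟨b, hb, rfl⟩
        exact ⟨a + b, add_mem ha hb, by ring⟩
  refine relationType_le I (by omega) fun n hn => ?_
  obtain ⟨s, rfl⟩ : ∃ s, n = s + 2 := ⟨n - 2, by omega⟩
  exact subsingleton_effectiveRelations_of_reduction I hx hreg (hred' s (by omega))

theorem relationType_bot : relationType (⊥ : Ideal A) ≤ 1 := by
  refine relationType_le _ le_rfl fun n hn => ?_
  rw [subsingleton_effectiveRelations_iff]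
  have h : symPiece (⊥ : Ideal A) n = ⊥ := by
    have h0 : LinearMap.range (SymmetricAlgebra.ι A (⊥ : Ideal A)) = ⊥ := by
      rw [LinearMap.range_eq_bot]
      ext x
      rw [Subsingleton.elim x 0, map_zero, map_zero]
    rw [symPiece, h0, Submodule.bot_pow (by omega)]
  exact le_trans inf_le_right (h.le.trans bot_le)

/-- An algebra morphism on the symmetric algebra which kills the relations of degree `n`, but not
all those of degree `n + 1`, detects `E(I)ₙ₊₁ ≠ 0`. -/
theorem not_subsingleton_effectiveRelations {B : Type*} [CommRing B] [Algebra A B]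
    (φ : SymmetricAlgebra A I →ₐ[A] B) {n : ℕ} (h : ∀ z ∈ relations I n, φ z = 0)
    {z : SymmetricAlgebra A I} (hz : z ∈ relations I (n + 1)) (hφ : φ z ≠ 0) :
    ¬ Subsingleton (EffectiveRelations I (n + 1)) := by
  rw [subsingleton_effectiveRelations_iff]
  intro hle
  apply hφ
  have := hle hz
  clear hφ hz
  induction this using Submodule.mul_induction_on' with
  | mem_mul_mem x _ y hy => rw [map_mul, h y hy, mul_zero]
  | add x _ y _ hx hy => rw [map_add, hx, hy, add_zero]

theorem eq_zero_of_mem_relations_one {z : SymmetricAlgebra A I} (hz : z ∈ relations I 1) :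
    z = 0 := by
  obtain ⟨hz0, hz1⟩ := (mem_relations I).1 hz
  rw [symPiece, pow_one] at hz1
  obtain ⟨x, rfl⟩ := hz1
  have h1 := congrArg (Subtype.val) hz0
  rw [symToRees_ι, Subalgebra.coe_zero, monomial_eq_zero_iff] at h1
  rw [Subtype.ext h1 (a2 := (0 : I)), map_zero]

end Relations

end GlobalRelationType

namespace GlobalRelationType

/-! ### Truncated subrings of `k⟦t⟧`: units, residue field, dimension. -/

section Embedding

universe u

variable {k : Type*} [Field k] {A : Type u} [CommRing A] [Algebra k A]

theorem exists_isUnit_mul_eq_X_pow_order {f : PowerSeries k} (hf : f ≠ 0) :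
    ∃ w : PowerSeries k, IsUnit w ∧ f * w = PowerSeries.X ^ f.order.toNat := by
  obtain ⟨w, hw⟩ := (PowerSeries.isUnit_divided_by_X_pow_order hf).exists_right_inv
  refine ⟨w, .of_mul_eq_one_right _ hw, ?_⟩
  conv_lhs => rw [← PowerSeries.X_pow_order_mul_divXPowOrder (f := f)]
  rw [mul_assoc, hw, mul_one]

/-- The `k`-algebra `A` embeds into `k⟦t⟧` as a subring of `k + t^(g+1) k⟦t⟧` which behaves, with
respect to divisibility and monomials, like `k + t^(g+1) V` for a discrete valuation ring
`V ⊆ k⟦t⟧` with uniformizer `t`. -/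
structure IsTruncatedEmbedding (g : ℕ) (ι : A →ₐ[k] PowerSeries k) : Prop where
  injective : Function.Injective ι
  coeff_eq_zero : ∀ a i, 1 ≤ i → i ≤ g → PowerSeries.coeff i (ι a) = 0
  dvd : ∀ f x, x ≠ 0 → PowerSeries.X ^ (g + 1) * ι x ∣ ι f → x ∣ f
  exists_eq_X_pow : ∀ j, g + 1 ≤ j → ∃ a, ι a = PowerSeries.X ^ j

namespace IsTruncatedEmbedding

variable {g : ℕ} {ι : A →ₐ[k] PowerSeries k} (h : IsTruncatedEmbedding g ι)

include h

theorem map_ne_zero {x : A} (hx : x ≠ 0) : ι x ≠ 0 :=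
  (map_ne_zero_iff ι h.injective).2 hx

theorem isDomain : IsDomain A := h.injective.isDomain ι.toRingHom

theorem X_pow_dvd_of_constantCoeff {a : A} (ha : PowerSeries.constantCoeff (ι a) = 0) :
    PowerSeries.X ^ (g + 1) ∣ ι a := by
  rw [PowerSeries.X_pow_dvd_iff]
  intro i hi
  rcases Nat.eq_zero_or_pos i with rfl | hi0
  · simpa using ha
  · exact h.coeff_eq_zero a i hi0 (by omega)

/-- If the constant term `c` is nonzero, `ι a` is a unit of `k⟦t⟧` and `a - c` has order at least `g
+ 1`. So `a` divides `a - c`, hence the unit `c`. -/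
theorem isUnit_iff {a : A} : IsUnit a ↔ PowerSeries.constantCoeff (ι a) ≠ 0 := by
  refine ⟨fun ha => ((ha.map ι).map PowerSeries.constantCoeff).ne_zero, fun ha => ?_⟩
  set c := PowerSeries.constantCoeff (ι a) with hc
  have hu : IsUnit (ι a) := PowerSeries.isUnit_iff_constantCoeff.2 ha.isUnit
  have h0 : a ≠ 0 := by
    rintro rfl
    simp [hc] at ha
  have h1 : a ∣ a - algebraMap k A c := by
    refine h.dvd _ _ h0 ?_
    rw [hu.mul_right_dvd]
    refine h.X_pow_dvd_of_constantCoeff ?_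
    rw [map_sub, AlgHom.commutes, map_sub, ← hc]
    simp
  have h2 : a ∣ algebraMap k A c := by
    have := dvd_sub (dvd_refl a) h1
    rwa [sub_sub_cancel] at this
  exact isUnit_of_dvd_unit h2 (ha.isUnit.map _)

theorem mem_maximalIdeal_iff [IsLocalRing A] {a : A} :
    a ∈ IsLocalRing.maximalIdeal A ↔ PowerSeries.X ^ (g + 1) ∣ ι a := by
  rw [IsLocalRing.mem_maximalIdeal, mem_nonunits_iff, h.isUnit_iff, not_not]
  refine ⟨h.X_pow_dvd_of_constantCoeff, fun hd => ?_⟩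
  rw [PowerSeries.X_pow_dvd_iff] at hd
  simpa using hd 0 (by omega)

theorem residueField_bijective [IsLocalRing A] :
    Function.Bijective (algebraMap k (IsLocalRing.ResidueField A)) := by
  refine ⟨RingHom.injective _, fun y => ?_⟩
  obtain ⟨a, rfl⟩ := IsLocalRing.residue_surjective y
  refine ⟨PowerSeries.constantCoeff (ι a), ?_⟩
  rw [IsScalarTower.algebraMap_apply k A (IsLocalRing.ResidueField A),
    IsLocalRing.ResidueField.algebraMap_eq, ← sub_eq_zero, ← map_sub, IsLocalRing.residue_eq_zero_iff,
    h.mem_maximalIdeal_iff]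
  refine h.X_pow_dvd_of_constantCoeff ?_
  rw [map_sub, AlgHom.commutes, map_sub]
  simp

theorem ringKrullDim_eq_one [IsLocalRing A] : ringKrullDim A = 1 := by
  have := h.isDomain
  rw [ringKrullDim_eq_one_iff_of_isLocalRing_isDomain]
  constructor
  · rw [IsLocalRing.isField_iff_maximalIdeal_eq]
    obtain ⟨a, ha⟩ := h.exists_eq_X_pow (g + 1) le_rfl
    intro hbot
    have h1 : a ∈ IsLocalRing.maximalIdeal A := h.mem_maximalIdeal_iff.2 (ha ▸ dvd_rfl)
    rw [hbot, Ideal.mem_bot] at h1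
    rw [h1, map_zero] at ha
    exact pow_ne_zero _ PowerSeries.X_ne_zero ha.symm
  · intro x hx y hy
    obtain ⟨w, -, hw⟩ := exists_isUnit_mul_eq_X_pow_order (h.map_ne_zero hx)
    rw [h.mem_maximalIdeal_iff] at hy
    -- One factor `y` supplies the surplus `t^(g+1)`; each of the remaining ones supplies at least
    -- one `t` towards the order of `x`.
    refine ⟨1 + (ι x).order.toNat, Ideal.mem_span_singleton.2 (h.dvd _ _ hx ?_)⟩
    rw [map_pow, pow_add (ι y), pow_one]
    refine mul_dvd_mul hy ((Dvd.intro _ hw).trans (pow_dvd_pow_of_dvd ?_ _))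
    exact (dvd_pow_self _ (by omega)).trans hy

end IsTruncatedEmbedding

end Embedding

end GlobalRelationType

noncomputable section

namespace GlobalRelationType

/-! ### Principal reductions and the upper bound. -/

section Embedding

universe u

variable {k : Type*} [Field k] {A : Type u} [CommRing A] [Algebra k A]

/-- The elements of `A` whose image in `k⟦t⟧` has order at least `j`. -/
def orderIdeal (ι : A →ₐ[k] PowerSeries k) (j : ℕ) : Ideal A :=
  (Ideal.span {PowerSeries.X ^ j}).comap ι

theorem mem_orderIdeal {ι : A →ₐ[k] PowerSeries k} {j : ℕ} {a : A} :
    a ∈ orderIdeal ι j ↔ PowerSeries.X ^ j ∣ ι a := by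
  rw [orderIdeal, Ideal.mem_comap, Ideal.mem_span_singleton]

theorem X_pow_dvd_map_of_mem_pow {ι : A →ₐ[k] PowerSeries k} {v : ℕ} {I : Ideal A}
    (hI : ∀ f ∈ I, PowerSeries.X ^ v ∣ ι f) {n : ℕ} {f : A} (hf : f ∈ I ^ n) :
    PowerSeries.X ^ (v * n) ∣ ι f := by
  rw [← mem_orderIdeal]
  revert hf f
  rw [← SetLike.le_def]
  induction n with
  | zero => exact fun _ _ => mem_orderIdeal.2 (by simp)
  | succ n ih =>
    rw [pow_succ, Ideal.mul_le]
    intro a ha b hb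
    rw [mem_orderIdeal, map_mul, mul_add, mul_one, pow_add]
    exact mul_dvd_mul (mem_orderIdeal.1 (ih ha)) (hI b hb)

namespace IsTruncatedEmbedding

variable {g : ℕ} {ι : A →ₐ[k] PowerSeries k} (h : IsTruncatedEmbedding g ι)

include h

/-- Every ideal `I` of `A` has a principal reduction, with reduction number at most `g`. -/
theorem exists_reduction {I : Ideal A} (hI : I ≠ ⊥) :
    ∃ x ∈ I, x ≠ 0 ∧ ∃ n ≤ g, ∀ f ∈ I ^ (n + 1), ∃ f' ∈ I ^ n, f = x * f' := by
  obtain ⟨x, ⟨hxI, hx0⟩, hmin⟩ : ∃ x, (x ∈ I ∧ x ≠ 0) ∧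
      ∀ y, (y ∈ I ∧ y ≠ 0) → (ι x).order.toNat ≤ (ι y).order.toNat := by
    obtain ⟨x₀, hx₀⟩ := Submodule.exists_mem_ne_zero_of_ne_bot hI
    have := (measure fun x : A => (ι x).order.toNat).wf.has_min {x | x ∈ I ∧ x ≠ 0} ⟨x₀, hx₀⟩
    obtain ⟨x, hx, hm⟩ := this
    exact ⟨x, hx, fun y hy => not_lt.1 (hm y hy)⟩
  refine ⟨x, hxI, hx0, ?_⟩
  obtain ⟨w, hw, hxw⟩ := exists_isUnit_mul_eq_X_pow_order (h.map_ne_zero hx0)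
  set v := (ι x).order.toNat with hv
  have hIv : ∀ f ∈ I, PowerSeries.X ^ v ∣ ι f := by
    intro f hf
    rcases eq_or_ne f 0 with rfl | hf0
    · simp
    · exact (pow_dvd_pow _ (hmin f ⟨hf, hf0⟩)).trans PowerSeries.X_pow_order_dvd
  -- Since `x w = t^v`, multiplying by `wⁿ` and shifting by `v n` amounts to dividing by `xⁿ`: `ψ n
  -- f` lists the first `g + 1` coefficients of `f / xⁿ`.
  let ψ : ℕ → A →ₗ[k] (Fin (g + 1) → k) := fun n => LinearMap.pi fun i =>
    PowerSeries.coeff (i + v * n) ∘ₗ LinearMap.mulRight k (w ^ n) ∘ₗ ι.toLinearMap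
  have hψ : ∀ n f i, ψ n f i = PowerSeries.coeff (i + v * n) (ι f * w ^ n) := fun n f i => rfl
  have hψx : ∀ n f, ψ (n + 1) (x * f) = ψ n f := by
    intro n f
    ext i
    rw [hψ, hψ, map_mul ι]
    have : ι x * ι f * w ^ (n + 1) = PowerSeries.X ^ v * (ι f * w ^ n) := by
      rw [← hxw]; ring
    rw [this, show (i : ℕ) + v * (n + 1) = i + v * n + v by ring, PowerSeries.coeff_X_pow_mul]
  let N : ℕ → Submodule k (Fin (g + 1) → k) := fun n => ((I ^ n).restrictScalars k).map (ψ n)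
  have hmono : ∀ n, N n ≤ N (n + 1) := by
    rintro n _ ⟨f, hf, rfl⟩
    exact ⟨x * f, by rw [pow_succ']; exact Ideal.mul_mem_mul hxI hf, hψx n f⟩
  -- `N 0` contains the nonzero vector `ψ 0 1`, so `g + 1` strict inclusions would give `N (g + 1)`
  -- dimension at least `g + 2` inside `k^(g+1)`.
  obtain ⟨n, hn, hN⟩ : ∃ n ≤ g, N n = N (n + 1) := by
    by_contra! hne
    have hrank : ∀ n ≤ g + 1, n + 1 ≤ Module.finrank k (N n) := by
      intro n
      induction n with
      | zero =>
        intro _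
        have h1 : ψ 0 1 ∈ N 0 := ⟨1, by simp, rfl⟩
        have h2 : ψ 0 1 ≠ 0 := by
          intro h0
          have := congrFun h0 0
          rw [hψ] at this
          simp at this
        exact Submodule.one_le_finrank_iff.2 (Submodule.ne_bot_iff _ |>.2 ⟨_, h1, h2⟩)
      | succ n ih =>
        intro hn
        have h1 := ih (by omega)
        have h2 := Submodule.finrank_lt_finrank_of_lt ((hmono n).lt_of_ne (hne n (by omega)))
        omega
    have h1 := hrank (g + 1) le_rfl
    have h2 := Submodule.finrank_le (N (g + 1))
    rw [Module.finrank_fin_fun] at h2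
    omega
  refine ⟨n, hn, fun f hf => ?_⟩
  obtain ⟨f', hf', hff'⟩ : ψ (n + 1) f ∈ N n := hN ▸ ⟨f, hf, rfl⟩
  have hF : f - x * f' ∈ I ^ (n + 1) :=
    sub_mem hf (by rw [pow_succ']; exact Ideal.mul_mem_mul hxI hf')
  have hF0 : ψ (n + 1) (f - x * f') = 0 := by rw [map_sub, hψx, hff', sub_self]
  obtain ⟨q, hq⟩ := (X_pow_dvd_map_of_mem_pow hIv hF).mul_right (w ^ (n + 1))
  have hqd : PowerSeries.X ^ (g + 1) ∣ q := by
    rw [PowerSeries.X_pow_dvd_iff]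
    intro i hi
    have := congrFun hF0 ⟨i, hi⟩
    rwa [hψ, hq, PowerSeries.coeff_X_pow_mul] at this
  -- The quotient of `f - x f'` by `x^(n+1)` starts in order at least `g + 1`, which is the surplus
  -- needed for divisibility inside `A`.
  have hdvd : PowerSeries.X ^ (g + 1) * ι (x ^ (n + 1)) ∣ ι (f - x * f') := by
    have h1 : PowerSeries.X ^ (g + 1) * (ι x * w) ^ (n + 1) ∣ ι (f - x * f') * w ^ (n + 1) := by
      rw [hq, hxw, ← pow_mul, mul_comm]
      exact mul_dvd_mul_left _ hqd
    rw [(hw.pow _).dvd_mul_right] at h1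
    rw [map_pow]
    exact (mul_dvd_mul_left _ (pow_dvd_pow_of_dvd (Dvd.intro _ rfl) _)).trans h1
  have := h.isDomain
  obtain ⟨a, ha⟩ := h.dvd _ _ (pow_ne_zero _ hx0) hdvd
  refine ⟨f' + x ^ n * a, add_mem hf' (Ideal.mul_mem_right _ _ (Ideal.pow_mem_pow hxI n)), ?_⟩
  rw [eq_add_of_sub_eq ha]
  ring

theorem globalRelationType_le : globalRelationType A ≤ (g + 1 : ℕ) := by
  have := h.isDomain
  refine iSup_le fun I => ?_
  rcases eq_or_ne I ⊥ with rfl | hI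
  · exact (relationType_bot (A := A)).trans (by exact_mod_cast Nat.le_add_left 1 g)
  · obtain ⟨x, hx, hx0, n, hn, hred⟩ := h.exists_reduction hI
    refine (relationType_le_of_reduction I hx
      (fun a ha => (mul_eq_zero.1 ha).resolve_left hx0) hred).trans ?_
    exact_mod_cast Nat.add_le_add_right hn 1

theorem exists_eq_mul_of_mem_orderIdeal {x : A} (hx : ι x = PowerSeries.X ^ (g + 1)) {j : ℕ} {f : A}
    (hf : f ∈ orderIdeal ι (g + 1 + (g + 1 + j))) : ∃ c ∈ orderIdeal ι (g + 1 + j), f = x * c := by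
  have hx0 : x ≠ 0 := by
    rintro rfl
    rw [map_zero] at hx
    exact pow_ne_zero _ PowerSeries.X_ne_zero hx.symm
  rw [mem_orderIdeal] at hf
  obtain ⟨c, rfl⟩ := h.dvd f x hx0 (by
    rw [hx, ← pow_add]
    exact (pow_dvd_pow _ (by omega)).trans hf)
  refine ⟨c, mem_orderIdeal.2 ?_, rfl⟩
  rw [map_mul, hx, pow_add] at hf
  exact (mul_dvd_mul_iff_left (pow_ne_zero _ PowerSeries.X_ne_zero)).1 hf

/-! ### Powers of the maximal ideal and the multiplicity. -/

variable [IsLocalRing A]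

theorem maximalIdeal_eq : IsLocalRing.maximalIdeal A = orderIdeal ι (g + 1) := by
  ext a
  rw [h.mem_maximalIdeal_iff, mem_orderIdeal]

theorem maximalIdeal_pow_eq (n : ℕ) :
    IsLocalRing.maximalIdeal A ^ (n + 1) = orderIdeal ι ((g + 1) * (n + 1)) := by
  refine le_antisymm (fun f hf => mem_orderIdeal.2
    (X_pow_dvd_map_of_mem_pow (fun a ha => h.mem_maximalIdeal_iff.1 ha) hf)) ?_
  induction n with
  | zero => rw [zero_add, pow_one, mul_one, h.maximalIdeal_eq]
  | succ n ih =>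
    intro f hf
    obtain ⟨x, hx⟩ := h.exists_eq_X_pow (g + 1) le_rfl
    have h1 : (g + 1) * (n + 1 + 1) = g + 1 + (g + 1 + (g + 1) * n) := by ring
    rw [h1] at hf
    obtain ⟨c, hc, rfl⟩ := h.exists_eq_mul_of_mem_orderIdeal hx hf
    rw [pow_succ']
    refine Ideal.mul_mem_mul (h.mem_maximalIdeal_iff.2 (hx ▸ dvd_rfl)) (ih ?_)
    rwa [mul_add, mul_one, add_comm]

/-- Multiplication by `t^(g+1+i)` identifies `A/𝔪` with the kernel of the projection between
consecutive quotients, so each step adds length one. -/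
theorem length_quotient_orderIdeal (i : ℕ) :
    Module.length A (A ⧸ orderIdeal ι (g + 1 + i)) = (i + 1 : ℕ) := by
  have hm : Module.length A (A ⧸ IsLocalRing.maximalIdeal A) = 1 := by
    rw [Module.length_eq_one_iff]
    exact isSimpleModule_iff_isCoatom.2 (IsLocalRing.maximalIdeal.isMaximal A).out
  induction i with
  | zero => rw [add_zero, ← h.maximalIdeal_eq, hm]; rfl
  | succ i ih =>
    obtain ⟨y, hy⟩ := h.exists_eq_X_pow (g + 1 + i) (by omega)
    have hle : orderIdeal ι (g + 1 + (i + 1)) ≤ orderIdeal ι (g + 1 + i) := fun a ha =>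
      mem_orderIdeal.2 ((pow_dvd_pow _ (by omega)).trans (mem_orderIdeal.1 ha))
    have hmul : ∀ a, a * y ∈ orderIdeal ι (g + 1 + (i + 1)) ↔ a ∈ IsLocalRing.maximalIdeal A := by
      intro a
      rw [mem_orderIdeal, map_mul, hy, ← add_assoc, pow_succ', mul_dvd_mul_iff_right
        (pow_ne_zero _ PowerSeries.X_ne_zero), PowerSeries.X_dvd_iff, IsLocalRing.mem_maximalIdeal,
        mem_nonunits_iff, h.isUnit_iff, not_not]
    let f₀ : A →ₗ[A] A ⧸ orderIdeal ι (g + 1 + (i + 1)) :=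
      (Submodule.mkQ _) ∘ₗ LinearMap.mulRight A y
    have hf₀ : ∀ a, f₀ a = 0 ↔ a ∈ IsLocalRing.maximalIdeal A := by
      intro a
      rw [← hmul]
      exact Submodule.Quotient.mk_eq_zero _
    let f : (A ⧸ IsLocalRing.maximalIdeal A) →ₗ[A] A ⧸ orderIdeal ι (g + 1 + (i + 1)) :=
      Submodule.liftQ _ f₀ fun a ha => (hf₀ a).2 ha
    let p : (A ⧸ orderIdeal ι (g + 1 + (i + 1))) →ₗ[A] A ⧸ orderIdeal ι (g + 1 + i) :=
      Submodule.factor hle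
    have hf : Function.Injective f := by
      rw [← LinearMap.ker_eq_bot]
      exact Submodule.ker_liftQ_eq_bot _ _ _ fun a ha => (hf₀ a).1 ha
    have hp : Function.Surjective p := Submodule.factor_surjective hle
    have hex : Function.Exact f p := by
      intro z
      obtain ⟨b, rfl⟩ := Submodule.mkQ_surjective _ z
      constructor
      · intro hb
        have hb' : b ∈ orderIdeal ι (g + 1 + i) := (Submodule.Quotient.mk_eq_zero _).1 hb
        obtain ⟨q, hq⟩ := mem_orderIdeal.1 hb'
        -- Subtracting (leading coefficient) · `t^(g+1+i)` from `b` raises its order.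
        refine ⟨Submodule.mkQ _ (algebraMap k A (PowerSeries.constantCoeff q)), ?_⟩
        refine (Submodule.Quotient.eq _).2 (mem_orderIdeal.2 ?_)
        change _ ∣ ι (algebraMap k A (PowerSeries.constantCoeff q) * y - b)
        rw [map_sub, map_mul, hy, hq, AlgHom.commutes, mul_comm, ← mul_sub, ← add_assoc, pow_succ]
        refine mul_dvd_mul_left _ (PowerSeries.X_dvd_iff.2 ?_)
        rw [map_sub]
        simp
      · rintro ⟨z, hz⟩
        obtain ⟨a, rfl⟩ := Submodule.mkQ_surjective _ z
        rw [← hz]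
        refine (Submodule.Quotient.mk_eq_zero _).2 (mem_orderIdeal.2 ?_)
        change _ ∣ ι (a * y)
        rw [map_mul, hy]
        exact dvd_mul_left _ _
    rw [Module.length_eq_add_of_exact f p hf hp hex, hm, ih]
    push_cast
    ring

theorem hasMultiplicity : HasMultiplicity A (g + 1) := by
  -- The length of `A/𝔪ⁿ` is `(g+1)(n-1) + 1 = (g+1)n - g` for `n ≥ 1`.
  refine ⟨1, C ((g : ℚ) + 1) * X + C (-(g : ℚ)), ?_, ?_, ?_, 1, ?_⟩
  · rw [h.ringKrullDim_eq_one]; rfl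
  · exact natDegree_linear (by positivity)
  · rw [leadingCoeff_linear (by positivity)]
    simp
  · intro n hn
    obtain ⟨n, rfl⟩ : ∃ m, n = m + 1 := ⟨n - 1, by omega⟩
    refine ⟨(g + 1) * n + 1, ?_, ?_⟩
    · rw [h.maximalIdeal_pow_eq, mul_add, mul_one, add_comm, h.length_quotient_orderIdeal]
    · simp
      ring

end IsTruncatedEmbedding

end Embedding

end GlobalRelationType

end

noncomputable section

namespace GlobalRelationType

/-! ### The lower bound and the relation type of the maximal ideal. -/

section Embedding

universe u

variable {k : Type*} [Field k] {A : Type u} [CommRing A] [Algebra k A]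

namespace IsTruncatedEmbedding

variable {g : ℕ} {ι : A →ₐ[k] PowerSeries k} (h : IsTruncatedEmbedding g ι)

/-- The two lowest coefficients of the elements of an ideal contained in the maximal ideal of `A`,
as an `A`-linear map with values in the polynomials of degree at most one over the residue
field. -/
def lowestCoeffs (hg : 1 ≤ g) [Algebra A k]
    (hc : ∀ a, algebraMap A k a = PowerSeries.constantCoeff (ι a)) (I : Ideal A)
    (hI : ∀ f ∈ I, PowerSeries.X ^ (g + 1) ∣ ι f) : I →ₗ[A] k[X] where
  toFun f := C (PowerSeries.coeff (g + 1) (ι f)) + C (PowerSeries.coeff (g + 2) (ι f)) * X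
  map_add' f f' := by
    rw [Submodule.coe_add, map_add, map_add, map_add (PowerSeries.coeff (g + 2)), C_add, C_add]
    ring
  map_smul' a f := by
    obtain ⟨q, hq⟩ := hI f f.2
    -- Linearity through the residue field rests on elements of `A` having no term in `t`; this is
    -- where `1 ≤ g` enters.
    have h1 : PowerSeries.coeff 1 (ι a * q) =
        PowerSeries.constantCoeff (ι a) * PowerSeries.coeff 1 q := by
      have h2 := h.coeff_eq_zero a 1 le_rfl hg
      rw [PowerSeries.coeff_mul, Finset.Nat.antidiagonal_succ]
      simp [h2]
    have h0 : PowerSeries.coeff 0 (ι a * q) =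
        PowerSeries.constantCoeff (ι a) * PowerSeries.coeff 0 q := by simp
    have hm : ι a * (PowerSeries.X ^ (g + 1) * q) = PowerSeries.X ^ (g + 1) * (ι a * q) := by ring
    have hs : ∀ r : PowerSeries k, PowerSeries.coeff (g + 1) (PowerSeries.X ^ (g + 1) * r) =
        PowerSeries.coeff 0 r := fun r => by
      simpa using PowerSeries.coeff_X_pow_mul r (g + 1) 0
    have hs' : ∀ r : PowerSeries k, PowerSeries.coeff (g + 2) (PowerSeries.X ^ (g + 1) * r) =
        PowerSeries.coeff 1 r := fun r => by
      rw [← PowerSeries.coeff_X_pow_mul r (g + 1) 1, show g + 2 = 1 + (g + 1) by ring]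
    rw [RingHom.id_apply, Algebra.smul_def, Submodule.coe_smul, smul_eq_mul, map_mul, hq, hm, hs,
      hs', hs, hs', h0, h1, ← hc, IsScalarTower.algebraMap_apply A k k[X], C_mul, C_mul,
      Polynomial.algebraMap_eq]
    ring

theorem lowestCoeffs_apply (hg : 1 ≤ g) [Algebra A k]
    (hc : ∀ a, algebraMap A k a = PowerSeries.constantCoeff (ι a)) (I : Ideal A)
    (hI : ∀ f ∈ I, PowerSeries.X ^ (g + 1) ∣ ι f) (f : I) {j : ℕ}
    (hf : ι f = PowerSeries.X ^ j) :
    h.lowestCoeffs hg hc I hI f =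
      C (if g + 1 = j then 1 else 0) + C (if g + 2 = j then 1 else 0) * X := by
  change C (PowerSeries.coeff (g + 1) (ι f)) + C (PowerSeries.coeff (g + 2) (ι f)) * X = _
  rw [hf, PowerSeries.coeff_X_pow, PowerSeries.coeff_X_pow]

include h

/-- For an ideal of elements congruent to `t^(g+1) (a₀ + a₁ t)` modulo `t^(2g+2)`, the values of
the induced map on the `n`-th piece of the symmetric algebra are polynomials of degree at most `n`
which, modulo `t^(g+1)`, agree with the image in the Rees algebra. -/
theorem natDegree_le_and_dvd_of_mem_symPiece (hg : 1 ≤ g) [Algebra A k]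
    (hc : ∀ a, algebraMap A k a = PowerSeries.constantCoeff (ι a)) (I : Ideal A)
    (hI : ∀ f ∈ I, PowerSeries.X ^ (g + 1) ∣ ι f)
    (hI₂ : ∀ f : I, PowerSeries.X ^ (g + 1 + (g + 1)) ∣
      ι f - PowerSeries.X ^ (g + 1) * (h.lowestCoeffs hg hc I hI f : PowerSeries k)) {n : ℕ}
    {z : SymmetricAlgebra A I} (hz : z ∈ symPiece I n) :
    (SymmetricAlgebra.lift (h.lowestCoeffs hg hc I hI) z).natDegree ≤ n ∧
    ∃ c, ((symToRees I z : reesAlgebra I) : A[X]) = monomial n c ∧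
      PowerSeries.X ^ ((g + 1) * n + (g + 1)) ∣ ι c - PowerSeries.X ^ ((g + 1) * n) *
        (SymmetricAlgebra.lift (h.lowestCoeffs hg hc I hI) z : PowerSeries k) := by
  set φ := SymmetricAlgebra.lift (h.lowestCoeffs hg hc I hI)
  rw [symPiece] at hz
  induction hz using Submodule.pow_induction_on_left' with
  | algebraMap r =>
    rw [AlgHom.commutes, AlgHom.commutes, IsScalarTower.algebraMap_apply A k k[X],
      Polynomial.algebraMap_eq]
    refine ⟨(natDegree_C _).le, r, rfl, ?_⟩
    rw [mul_zero, zero_add, pow_zero, one_mul, hc, Polynomial.coe_C, PowerSeries.X_pow_dvd_iff]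
    intro i hi
    rw [map_sub, PowerSeries.coeff_C]
    split_ifs with hi0
    · rw [hi0, PowerSeries.coeff_zero_eq_constantCoeff_apply, sub_self]
    · rw [h.coeff_eq_zero r i (by omega) (by omega), sub_zero]
  | add x y i hx hy ihx ihy =>
    obtain ⟨hdx, a, ha, hxa⟩ := ihx
    obtain ⟨hdy, b, hb, hyb⟩ := ihy
    refine ⟨by rw [map_add]; exact natDegree_add_le_of_degree_le hdx hdy, a + b,
      by rw [map_add, Subalgebra.coe_add, ha, hb, map_add], ?_⟩
    rw [map_add φ, map_add ι, Polynomial.coe_add, mul_add, add_sub_add_comm]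
    exact dvd_add hxa hyb
  | mem_mul m hm i x hx ih =>
    obtain ⟨hdx, a, ha, hxa⟩ := ih
    obtain ⟨y, rfl⟩ := hm
    have hφy : φ (SymmetricAlgebra.ι A I y) = h.lowestCoeffs hg hc I hI y :=
      SymmetricAlgebra.lift_ι_apply _ y
    have hdeg : (h.lowestCoeffs hg hc I hI y).natDegree ≤ 1 := by
      change (C _ + C _ * X).natDegree ≤ 1
      compute_degree
    refine ⟨?_, y * a, ?_, ?_⟩
    · rw [map_mul, hφy, Nat.succ_eq_add_one, add_comm i 1]
      exact natDegree_mul_le_of_le hdeg hdx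
    · rw [map_mul, Subalgebra.coe_mul, symToRees_ι, ha, monomial_mul_monomial, add_comm 1 i]
    · rw [map_mul φ, hφy, map_mul ι, Polynomial.coe_mul]
      obtain ⟨p, hp⟩ := hI y y.2
      obtain ⟨d, hd⟩ := hI₂ y
      obtain ⟨e, he⟩ := hxa
      -- The error of a product: `y`, of order at least `g + 1`, times the error `e` of `a`, plus
      -- the error `d` of `y` times the approximation of `a`.
      refine ⟨p * e + d * (φ x : PowerSeries k), ?_⟩
      rw [sub_eq_iff_eq_add] at hd he
      rw [Nat.succ_eq_add_one, mul_add, mul_one, pow_add, pow_add]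
      have h1 : ι (y : A) * ι a = ι y * (PowerSeries.X ^ ((g + 1) * i + (g + 1)) * e) +
        ι y * (PowerSeries.X ^ ((g + 1) * i) * (φ x : PowerSeries k)) := by rw [he]; ring
      rw [h1]
      conv_lhs =>
        enter [1, 1]
        rw [hp]
      conv_lhs =>
        enter [1, 2]
        rw [hd]
      ring

theorem le_globalRelationType (hg : 1 ≤ g) : (g + 1 : ℕ) ≤ globalRelationType A := by
  let _ : Algebra A k := (PowerSeries.constantCoeff.comp ι.toRingHom).toAlgebra
  have hc : ∀ a, algebraMap A k a = PowerSeries.constantCoeff (ι a) := fun _ => rfl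
  obtain ⟨a, ha⟩ := h.exists_eq_X_pow (g + 1) le_rfl
  obtain ⟨b, hb⟩ := h.exists_eq_X_pow (g + 2) (by omega)
  set I : Ideal A := Ideal.span {a, b} with hIdef
  have haI : a ∈ I := Ideal.subset_span (by simp)
  have hbI : b ∈ I := Ideal.subset_span (by simp)
  -- With only two generators, `f = t^(g+1) (p + q t)` with `p, q ∈ A`, so the second factor is
  -- linear modulo `t^(g+1)`.
  have hI' : ∀ f ∈ I, ∃ q, ι f = PowerSeries.X ^ (g + 1) * q ∧
      ∀ i, 2 ≤ i → i ≤ g → PowerSeries.coeff i q = 0 := by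
    intro f hf
    obtain ⟨p, q, rfl⟩ := Ideal.mem_span_pair.1 hf
    refine ⟨ι p + ι q * PowerSeries.X, ?_, fun i hi hig => ?_⟩
    · rw [map_add, map_mul, map_mul, ha, hb]
      ring
    · obtain ⟨j, rfl⟩ : ∃ j, i = j + 1 := ⟨i - 1, by omega⟩
      rw [map_add, PowerSeries.coeff_succ_mul_X, h.coeff_eq_zero _ _ (by omega) hig,
        h.coeff_eq_zero _ _ (by omega) (by omega), add_zero]
  have hI : ∀ f ∈ I, PowerSeries.X ^ (g + 1) ∣ ι f := fun f hf => by
    obtain ⟨q, hq, -⟩ := hI' f hf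
    exact ⟨q, hq⟩
  have hI₂ : ∀ f : I, PowerSeries.X ^ (g + 1 + (g + 1)) ∣
      ι f - PowerSeries.X ^ (g + 1) * (h.lowestCoeffs hg hc I hI f : PowerSeries k) := by
    intro f
    obtain ⟨q, hq, hq0⟩ := hI' f f.2
    have h0 : PowerSeries.coeff (g + 1) (ι (f : A)) = PowerSeries.coeff 0 q := by
      rw [hq]; simpa using PowerSeries.coeff_X_pow_mul q (g + 1) 0
    have h1 : PowerSeries.coeff (g + 2) (ι (f : A)) = PowerSeries.coeff 1 q := by
      rw [hq, ← PowerSeries.coeff_X_pow_mul q (g + 1) 1, show g + 2 = 1 + (g + 1) by ring]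
    have hl : (h.lowestCoeffs hg hc I hI f) = C (PowerSeries.coeff 0 q) +
        C (PowerSeries.coeff 1 q) * X := by
      rw [← h0, ← h1]; rfl
    rw [hl, hq, ← mul_sub, pow_add]
    refine mul_dvd_mul_left _ (PowerSeries.X_pow_dvd_iff.2 fun i hi => ?_)
    rw [map_sub, Polynomial.coeff_coe, coeff_add, coeff_C, coeff_C_mul, coeff_X]
    rcases i with _ | _ | i
    · simp
    · simp
    · rw [hq0 _ (by omega) (by omega)]
      simp
  -- The value is a polynomial of degree at most `g` divisible by `t^(g+1)`, hence zero.
  have hkill : ∀ z ∈ relations I g,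
      SymmetricAlgebra.lift (h.lowestCoeffs hg hc I hI) z = 0 := by
    intro z hz
    obtain ⟨hz0, hz1⟩ := (mem_relations I).1 hz
    obtain ⟨hdeg, c, hzc, hdvd⟩ :=
      h.natDegree_le_and_dvd_of_mem_symPiece hg hc I hI hI₂ hz1
    rw [hz0, Subalgebra.coe_zero, eq_comm, monomial_eq_zero_iff] at hzc
    rw [hzc, map_zero, zero_sub, dvd_neg, pow_add,
      mul_dvd_mul_iff_left (pow_ne_zero _ PowerSeries.X_ne_zero), PowerSeries.X_pow_dvd_iff] at hdvd
    ext i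
    rw [coeff_zero]
    rcases le_or_gt i g with hi | hi
    · rw [← Polynomial.coeff_coe]
      exact hdvd i (by omega)
    · exact coeff_eq_zero_of_natDegree_lt (by omega)
  have hpow : ∀ (y : I) n, SymmetricAlgebra.ι A I y ^ n ∈ symPiece I n := fun y n =>
    Submodule.pow_mem_pow _ (LinearMap.mem_range_self _ y) n
  -- The relation comes from `(t^(g+2))^(g+1) = t^(g+1) · (t^(g+1))^(g+1)`. The coefficient `a` acts
  -- as zero on `k[X]`, so only `X^(g+1)` survives.
  refine le_trans (le_relationType I (not_subsingleton_effectiveRelations I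
    (SymmetricAlgebra.lift (h.lowestCoeffs hg hc I hI)) hkill
    (z := SymmetricAlgebra.ι A I ⟨b, hbI⟩ ^ (g + 1) -
      a • SymmetricAlgebra.ι A I ⟨a, haI⟩ ^ (g + 1)) ?_ ?_)) (le_iSup _ I)
  · refine (mem_relations I).2 ⟨Subtype.ext ?_, sub_mem (hpow _ _) (Submodule.smul_mem _ _ (hpow _ _))⟩
    rw [map_sub, map_smul, map_pow, map_pow, Subalgebra.coe_sub, Subalgebra.coe_smul,
      Subalgebra.coe_pow, Subalgebra.coe_pow, symToRees_ι, symToRees_ι, monomial_pow, monomial_pow,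
      smul_monomial, ← map_sub, Subalgebra.coe_zero, monomial_eq_zero_iff]
    apply h.injective
    rw [map_sub, map_zero, smul_eq_mul, map_mul, map_pow, map_pow, ha, hb]
    ring
  · have h0 : algebraMap A k a = 0 := by rw [hc, ha]; simp
    rw [map_sub, map_smul, map_pow, SymmetricAlgebra.lift_ι_apply, h.lowestCoeffs_apply _ _ _ _ ⟨b, hbI⟩ hb,
      Algebra.smul_def, IsScalarTower.algebraMap_apply A k k[X], h0]
    simp

theorem relationType_maximalIdeal (hg : 1 ≤ g) [IsLocalRing A] :
    relationType (IsLocalRing.maximalIdeal A) = 2 := by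
  have := h.isDomain
  set I := IsLocalRing.maximalIdeal A with hIdef
  have hI : ∀ f, f ∈ I ↔ PowerSeries.X ^ (g + 1) ∣ ι f := fun f => h.mem_maximalIdeal_iff
  obtain ⟨a, ha⟩ := h.exists_eq_X_pow (g + 1) le_rfl
  obtain ⟨b, hb⟩ := h.exists_eq_X_pow (g + 2) (by omega)
  obtain ⟨c, hc⟩ := h.exists_eq_X_pow (g + 3) (by omega)
  have haI : a ∈ I := (hI a).2 (ha ▸ dvd_rfl)
  have hbI : b ∈ I := (hI b).2 (hb ▸ pow_dvd_pow _ (by omega))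
  have hcI : c ∈ I := (hI c).2 (hc ▸ pow_dvd_pow _ (by omega))
  have ha0 : a ≠ 0 := by
    rintro rfl
    rw [map_zero] at ha
    exact pow_ne_zero _ PowerSeries.X_ne_zero ha.symm
  refine le_antisymm ?_ ?_
  · refine relationType_le_of_reduction I haI (fun y hy => (mul_eq_zero.1 hy).resolve_left ha0)
      (r := 1) fun f hf => ?_
    rw [h.maximalIdeal_pow_eq, show (g + 1) * (1 + 1) = g + 1 + (g + 1 + 0) by ring] at hf
    obtain ⟨y, hy, rfl⟩ := h.exists_eq_mul_of_mem_orderIdeal ha hf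
    exact ⟨y, by rwa [pow_one, hIdef, h.maximalIdeal_eq], rfl⟩
  · let _ : Algebra A k := (PowerSeries.constantCoeff.comp ι.toRingHom).toAlgebra
    let l := h.lowestCoeffs hg (fun _ => rfl) I fun f => (hI f).1
    -- The relation is `b² = a c`; `b` maps to `X`, `a` to `1` and `c` to `0`, so its image is `X²`.
    refine le_relationType (n := 2) I (not_subsingleton_effectiveRelations I
      (SymmetricAlgebra.lift l)
      (fun z hz => by rw [eq_zero_of_mem_relations_one I hz, map_zero])
      (z := SymmetricAlgebra.ι A I ⟨b, hbI⟩ * SymmetricAlgebra.ι A I ⟨b, hbI⟩ -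
        SymmetricAlgebra.ι A I ⟨a, haI⟩ * SymmetricAlgebra.ι A I ⟨c, hcI⟩) ?_ ?_)
    · refine (mem_relations I).2 ⟨Subtype.ext ?_, sub_mem
        (ι_mul_mem_symPiece I _ (ι_mem_symPiece_one I _))
        (ι_mul_mem_symPiece I _ (ι_mem_symPiece_one I _))⟩
      rw [map_sub, map_mul, map_mul, Subalgebra.coe_sub, Subalgebra.coe_mul, Subalgebra.coe_mul,
        symToRees_ι, symToRees_ι, symToRees_ι, monomial_mul_monomial, monomial_mul_monomial,
        ← map_sub, Subalgebra.coe_zero, monomial_eq_zero_iff]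
      apply h.injective
      rw [map_sub, map_zero, map_mul, map_mul, ha, hb, hc]
      ring
    · rw [map_sub, map_mul, map_mul, SymmetricAlgebra.lift_ι_apply, SymmetricAlgebra.lift_ι_apply,
        SymmetricAlgebra.lift_ι_apply, h.lowestCoeffs_apply _ _ _ _ ⟨a, haI⟩ ha,
        h.lowestCoeffs_apply _ _ _ _ ⟨b, hbI⟩ hb, h.lowestCoeffs_apply _ _ _ _ ⟨c, hcI⟩ hc]
      simp

end IsTruncatedEmbedding

end Embedding

end GlobalRelationType

end

noncomputable section

namespace GlobalRelationType

/-! ### The localized monomial ring as a truncated subring of `k⟦t⟧`. -/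

section MonomialRing

universe u

variable (k : Type u) [Field k] (g : ℕ)

theorem X_pow_mem_monomialRing {n : ℕ} (hn : g + 1 ≤ n) : (X ^ n : k[X]) ∈ monomialRing k g := by
  induction n using Nat.strong_induction_on with
  | _ n ih =>
    rcases le_or_gt n (2 * g + 1) with h | h
    · exact Algebra.subset_adjoin ⟨n, Finset.mem_Icc.2 ⟨hn, h⟩, rfl⟩
    · have h1 : (X ^ n : k[X]) = X ^ (g + 1) * X ^ (n - (g + 1)) := by
        rw [← pow_add, Nat.add_sub_cancel' hn]
      rw [h1]
      exact mul_mem (Algebra.subset_adjoin ⟨g + 1, Finset.mem_Icc.2 ⟨le_rfl, by omega⟩, rfl⟩)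
        (ih _ (by omega) (by omega))

/-- `R = k + t^(g+1) k[t]`. -/
theorem mem_monomialRing_iff {p : k[X]} :
    p ∈ monomialRing k g ↔ ∀ i, 1 ≤ i → i ≤ g → p.coeff i = 0 := by
  constructor
  · intro hp
    change p ∈ Algebra.adjoin k _ at hp
    induction hp using Algebra.adjoin_induction with
    | mem x hx =>
      obtain ⟨j, hj, rfl⟩ := hx
      intro i _ hi
      have := (Finset.mem_Icc.1 hj).1
      rw [coeff_X_pow, if_neg (by omega)]
    | algebraMap c =>
      intro i hi _
      rw [Polynomial.algebraMap_eq, coeff_C, if_neg (by omega)]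
    | add x y hx hy ihx ihy =>
      intro i hi hi'
      rw [coeff_add, ihx i hi hi', ihy i hi hi', add_zero]
    | mul x y hx hy ihx ihy =>
      intro i hi hi'
      rw [coeff_mul]
      refine Finset.sum_eq_zero fun ⟨m, n⟩ hmn => ?_
      have hmn := Finset.HasAntidiagonal.mem_antidiagonal.1 hmn
      rcases Nat.eq_zero_or_pos m with hm | hm
      · rw [ihy n (by simp_all) (by simp_all), mul_zero]
      · rw [ihx m hm (by simp_all; omega), zero_mul]
  · intro hp
    rw [p.as_sum_support_C_mul_X_pow]
    refine sum_mem fun i _ => ?_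
    rcases Nat.eq_zero_or_pos i with rfl | hi
    · rw [pow_zero, mul_one]
      exact (monomialRing k g).algebraMap_mem _
    · rcases le_or_gt i g with hig | hig
      · rw [hp i hi hig, C_0, zero_mul]
        exact zero_mem _
      · exact mul_mem ((monomialRing k g).algebraMap_mem _) (X_pow_mem_monomialRing k g hig)

theorem mem_primeCompl_iff {r : monomialRing k g} :
    r ∈ (monomialIdeal k g).primeCompl ↔ (r : k[X]).coeff 0 ≠ 0 := by
  rw [Ideal.mem_primeCompl_iff, monomialIdeal_eq_ker, RingHom.mem_ker, coeff_zero_eq_aeval_zero]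
  rfl

/-- The expansion `R ⊆ k[t] ⊆ k⟦t⟧`. -/
def monomialRingToPowerSeries : monomialRing k g →ₐ[k] PowerSeries k :=
  (Polynomial.coeToPowerSeries.algHom k).comp (monomialRing k g).val

theorem monomialRingToPowerSeries_apply (r : monomialRing k g) :
    monomialRingToPowerSeries k g r = ((r : k[X]) : PowerSeries k) := by
  simp [monomialRingToPowerSeries, Polynomial.coeToPowerSeries.algHom_apply]

theorem isUnit_monomialRingToPowerSeries (s : (monomialIdeal k g).primeCompl) :
    IsUnit (monomialRingToPowerSeries k g s) := by
  rw [monomialRingToPowerSeries_apply, PowerSeries.isUnit_iff_constantCoeff,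
    Polynomial.constantCoeff_coe]
  exact ((mem_primeCompl_iff k g).1 s.2).isUnit

/-- The expansion `A → k⟦t⟧`. -/
def localToPowerSeries : LocalMonomialRing k g →ₐ[k] PowerSeries k :=
  IsLocalization.liftAlgHom (M := (monomialIdeal k g).primeCompl)
    (f := monomialRingToPowerSeries k g) (isUnit_monomialRingToPowerSeries k g)

theorem localToPowerSeries_algebraMap (r : monomialRing k g) :
    localToPowerSeries k g (algebraMap _ _ r) = ((r : k[X]) : PowerSeries k) := by
  rw [← monomialRingToPowerSeries_apply]
  exact IsLocalization.lift_eq _ r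

theorem isUnit_algebraMap {r : monomialRing k g} (hr : (r : k[X]).coeff 0 ≠ 0) :
    IsUnit (algebraMap (monomialRing k g) (LocalMonomialRing k g) r) :=
  IsLocalization.map_units _ (⟨r, (mem_primeCompl_iff k g).2 hr⟩ : (monomialIdeal k g).primeCompl)

theorem exists_mul_algebraMap_eq (a : LocalMonomialRing k g) :
    ∃ s r : monomialRing k g, (s : k[X]).coeff 0 ≠ 0 ∧
      a * algebraMap _ _ s = algebraMap _ (LocalMonomialRing k g) r := by
  obtain ⟨⟨r, s⟩, hrs⟩ := IsLocalization.surj (monomialIdeal k g).primeCompl a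
  exact ⟨s, r, (mem_primeCompl_iff k g).1 s.2, hrs⟩

/-- A nonzero polynomial divides, up to a factor invertible in `A` and a cofactor in
`t^(g+1) k[t]`, every polynomial whose order is larger by at least `g + 1`. -/
theorem exists_mul_eq_mul_of_X_pow_dvd {p q : k[X]} (hq : q ≠ 0)
    (hpq : (PowerSeries.X ^ (g + 1) * (q : PowerSeries k)) ∣ (p : PowerSeries k)) :
    ∃ r s : monomialRing k g, (r : k[X]).coeff 0 ≠ 0 ∧ p * r = q * s := by
  obtain ⟨q₁, hq₁, hXq₁⟩ := exists_eq_pow_rootMultiplicity_mul_and_not_dvd q hq 0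
  rw [C_0, sub_zero] at hq₁ hXq₁
  set v := q.rootMultiplicity 0
  have hp : X ^ (g + 1 + v) ∣ p := by
    rw [X_pow_dvd_iff]
    intro d hd
    rw [← Polynomial.coeff_coe]
    refine PowerSeries.X_pow_dvd_iff.1 ((?_ : _ ∣ _).trans hpq) d hd
    rw [hq₁, Polynomial.coe_mul, Polynomial.coe_pow, Polynomial.coe_X, pow_add]
    exact mul_dvd_mul_left _ (dvd_mul_right _ _)
  obtain ⟨p₁, rfl⟩ := hp
  -- The Bézout multiple `b * q₁` is `1` modulo `t^(g+1)`, so it lies in `R` and becomes a unit in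
  -- `A`, even though `q₁` itself need not lie in `R`.
  obtain ⟨a, b, hab⟩ : IsCoprime (X ^ (g + 1)) q₁ :=
    ((irreducible_X.coprime_iff_not_dvd).2 hXq₁).pow_left
  have hcoeff : ∀ i ≤ g, (b * q₁).coeff i = (1 : k[X]).coeff i := by
    intro i hi
    rw [← hab, coeff_add, coeff_mul_X_pow', if_neg (by omega), zero_add]
  refine ⟨⟨b * q₁, (mem_monomialRing_iff k g).2 fun i hi hig => ?_⟩,
    ⟨p₁ * b * X ^ (g + 1), (mem_monomialRing_iff k g).2 fun i hi hig => ?_⟩, ?_, ?_⟩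
  · rw [hcoeff i hig, coeff_one, if_neg (by omega)]
  · rw [coeff_mul_X_pow', if_neg (by omega)]
  · rw [hcoeff 0 (by omega), coeff_one_zero]
    exact one_ne_zero
  · change X ^ (g + 1 + v) * p₁ * (b * q₁) = q * (p₁ * b * X ^ (g + 1))
    rw [hq₁]
    ring

/-- Clearing denominators, which are elements of `R` with nonzero constant term, reduces the first
three properties to statements about polynomials. -/
theorem isTruncatedEmbedding : IsTruncatedEmbedding g (A := LocalMonomialRing k g) (localToPowerSeries k g) where
  injective := by
    refine (injective_iff_map_eq_zero _).2 fun a ha => ?_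
    obtain ⟨s, r, hs, hr⟩ := exists_mul_algebraMap_eq k g a
    have h1 := congrArg (localToPowerSeries k g) hr
    rw [map_mul, ha, zero_mul, localToPowerSeries_algebraMap, eq_comm,
      Polynomial.coe_eq_zero_iff] at h1
    have h2 : r = 0 := Subtype.ext h1
    rw [h2, map_zero] at hr
    exact (isUnit_algebraMap k g hs).mul_left_eq_zero.1 hr
  coeff_eq_zero a := by
    obtain ⟨s, r, hs, hr⟩ := exists_mul_algebraMap_eq k g a
    intro i hi hig
    have h1 := congrArg (fun b => PowerSeries.coeff i (localToPowerSeries k g b)) hr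
    simp only [map_mul, localToPowerSeries_algebraMap, Polynomial.coeff_coe] at h1
    -- The denominator `s` has no terms of degree `1, …, i`, so only its constant term contributes
    -- to the `i`-th coefficient of the product.
    rw [(mem_monomialRing_iff k g).1 r.2 i hi hig, PowerSeries.coeff_mul,
      Finset.sum_eq_single_of_mem (i, 0) (by simp)] at h1
    · rw [Polynomial.coeff_coe] at h1
      exact (mul_eq_zero.1 h1).resolve_right hs
    · rintro ⟨m, n⟩ hmn hne
      have hmn := Finset.HasAntidiagonal.mem_antidiagonal.1 hmn
      have hn : n ≠ 0 := by
        rintro rfl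
        exact hne (Prod.ext (by simpa using hmn) rfl)
      simp only at hmn
      rw [Polynomial.coeff_coe, (mem_monomialRing_iff k g).1 s.2 n (by omega) (by omega), mul_zero]
  dvd f x hx hd := by
    obtain ⟨u₀, p, hu₀, hp⟩ := exists_mul_algebraMap_eq k g f
    obtain ⟨w₀, q, hw₀, hq⟩ := exists_mul_algebraMap_eq k g x
    have hu := isUnit_algebraMap k g hu₀
    have hw := isUnit_algebraMap k g hw₀
    have hq0 : (q : k[X]) ≠ 0 := by
      intro h0
      have h1 : q = 0 := Subtype.ext h0
      rw [h1, map_zero] at hq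
      exact hx (hw.mul_left_eq_zero.1 hq)
    obtain ⟨r, s, hr, hrs⟩ := exists_mul_eq_mul_of_X_pow_dvd k g (p := p) hq0 (by
      rw [← localToPowerSeries_algebraMap, ← localToPowerSeries_algebraMap, ← hp, ← hq, map_mul,
        map_mul, ← mul_assoc, (hw.map _).mul_right_dvd, (hu.map _).dvd_mul_right]
      exact hd)
    have hrs' : p * r = q * s := Subtype.ext hrs
    have h1 : f * algebraMap _ _ u₀ * algebraMap _ _ r = x * algebraMap _ _ w₀ * algebraMap _ _ s := by
      rw [hp, hq, ← map_mul, ← map_mul, hrs']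
    rw [← (isUnit_algebraMap k g hr).dvd_mul_right (u := algebraMap _ _ r), ← hu.dvd_mul_right,
      mul_right_comm, h1, mul_assoc]
    exact dvd_mul_right _ _
  exists_eq_X_pow j hj :=
    ⟨algebraMap (monomialRing k g) _ ⟨X ^ j, X_pow_mem_monomialRing k g hj⟩, by
      rw [localToPowerSeries_algebraMap, Polynomial.coe_pow, Polynomial.coe_X]⟩

instance isNoetherianRing_monomialRing : IsNoetherianRing (monomialRing k g) := by
  refine isNoetherianRing_of_fg (Subalgebra.fg_def.2 ⟨_, ?_, rfl⟩)
  refine ((Finset.Icc (g + 1) (2 * g + 1)).finite_toSet.image fun i => (X ^ i : k[X])).subset ?_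
  rintro _ ⟨i, hi, rfl⟩
  exact ⟨i, hi, rfl⟩

end MonomialRing

end GlobalRelationType

end

theorem mainTheorem9 (k : Type*) [Field k] (g : ℕ) (hg : 1 ≤ g) :
    IsDomain (GlobalRelationType.LocalMonomialRing k g) ∧
    IsNoetherianRing (GlobalRelationType.LocalMonomialRing k g) ∧
    IsLocalRing (GlobalRelationType.LocalMonomialRing k g) ∧
    IsLocalRing.maximalIdeal (GlobalRelationType.LocalMonomialRing k g) =
      (GlobalRelationType.monomialIdeal k g).map
        (algebraMap (GlobalRelationType.monomialRing k g)
          (GlobalRelationType.LocalMonomialRing k g)) ∧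
    Function.Bijective (algebraMap k
      (IsLocalRing.ResidueField (GlobalRelationType.LocalMonomialRing k g))) ∧
    ringKrullDim (GlobalRelationType.LocalMonomialRing k g) = 1 ∧
    GlobalRelationType.globalRelationType (GlobalRelationType.LocalMonomialRing k g) =
      ((g + 1 : ℕ) : ℕ∞) ∧
    GlobalRelationType.HasMultiplicity (GlobalRelationType.LocalMonomialRing k g) (g + 1) ∧
    GlobalRelationType.relationType (A := GlobalRelationType.LocalMonomialRing k g)
      (IsLocalRing.maximalIdeal (GlobalRelationType.LocalMonomialRing k g)) = 2 := by
  have h := GlobalRelationType.isTruncatedEmbedding k g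
  exact ⟨h.isDomain, IsLocalization.isNoetherianRing (GlobalRelationType.monomialIdeal k g).primeCompl
      _ inferInstance, inferInstance, Localization.AtPrime.map_eq_maximalIdeal.symm,
    h.residueField_bijective, h.ringKrullDim_eq_one,
    le_antisymm h.globalRelationType_le (h.le_globalRelationType hg), h.hasMultiplicity,
    h.relationType_maximalIdeal hg⟩
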